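/- Let $K>0$ and $N\in(1,\infty)$ be real numbers, put $\kappa=K/(N-1)$, $s_\kappa(\theta)=\frac{1}{\sqrt{\kappa}}\sin(\sqrt{\kappa}\,\theta)$ and $D_{K,N}=\pi/\sqrt{\kappa}$. For $D\in(0,D_{K,N}]$ let $h_{K,N,D}:\mathbb{R}\to[0,\infty)$ be the density given by $h_{K,N,D}(x)=s_\kappa(D-x)^{N-1}$ for $x\in[0,D/2]$, $h_{K,N,D}(x)=s_\kappa(x)^{N-1}$ for $x\in[D/2,D]$, and $h_{K,N,D}(x)=0$ for $x\notin[0,D]$. For a non-negative density $h$ on $\mathbb{R}$ let $$\lambda[h]=\inf\left\{\frac{\int_{\mathbb{R}}|f'|^2\,h\,dx}{\int_{\mathbb{R}}|f|^2\,h\,dx}\;:\; f:\mathbb{R}\to\mathbb{R}\ \text{locally Lipschitz},\ \int_{\mathbb{R}} f\,h\,dx=0,\ 0<\int_{\mathbb{R}}|f|^2\,h\,dx<\infty\right\}$$ denote its Poincaré constant. Then the function $$(0,D_{K,N}]\ni D\mapsto\lambda[h_{K,N,D}]$$ is not non-increasing. Moreover, if $N\ge 13$, then $\lambda[h_{K,N,D_{K,N}/2}]<\lambda[h_{K,N,D_{K,N}}]$.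 -/

import Mathlib

open scoped ENNReal

noncomputable section

/-- The comparison function `s_κ`. -/
def sFun (κ θ : ℝ) : ℝ :=
  if 0 < κ then (1 / √κ) * Real.sin (√κ * θ)
  else if κ = 0 then θ
  else (1 / √(-κ)) * Real.sinh (√(-κ) * θ)

/-- The Bonnet--Myers diameter bound `D_{K,N} = π / √(K / (N - 1))`, for `K > 0` and `N > 1`
(for `K ≤ 0` the bound is infinite, and this real number is not used). -/
def bonnetMyers (K N : ℝ) : ℝ :=
  Real.pi / √(K / (N - 1))

/-- The model density `h_{K,N,D}` on `ℝ`, supported on `[0, D]`. -/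
def modelDensity (K N D : ℝ) (x : ℝ) : ℝ :=
  if 0 ≤ x ∧ x ≤ D / 2 then sFun (K / (N - 1)) (D - x) ^ (N - 1)
  else if D / 2 ≤ x ∧ x ≤ D then sFun (K / (N - 1)) x ^ (N - 1)
  else 0

/-- The Poincaré constant `λ[h]` of a non-negative density `h` on `ℝ`: the infimum of
`∫ |f'|² h / ∫ |f|² h` over the locally Lipschitz `f : ℝ → ℝ` with `∫ f h = 0` and
`0 < ∫ |f|² h < ∞`. A locally Lipschitz function is differentiable almost everywhere, so that
`deriv f` is its derivative almost everywhere. The two integrals in the quotient are integrals of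
non-negative functions with values in `[0, ∞]`. -/
def poincareConst (h : ℝ → ℝ) : ℝ≥0∞ :=
  sInf {q : ℝ≥0∞ | ∃ f : ℝ → ℝ, LocallyLipschitz f ∧
    MeasureTheory.Integrable (fun x => f x * h x) ∧ ∫ x, f x * h x = 0 ∧
    0 < ∫⁻ x, ENNReal.ofReal (f x ^ 2 * h x) ∧
    ∫⁻ x, ENNReal.ofReal (f x ^ 2 * h x) < ∞ ∧
    q = (∫⁻ x, ENNReal.ofReal (deriv f x ^ 2 * h x)) /
      ∫⁻ x, ENNReal.ofReal (f x ^ 2 * h x)}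

end

open MeasureTheory Filter Topology Set
open scoped ENNReal


/-! Both claims compare the Poincaré constant with the threshold `N * κ`, where κ = K/(N-1), r = √κ
and s is `sFun κ`.

At the full diameter π/r the density is s^(N-1), and the constant is at least Nκ
(`ofReal_le_poincareConst_bonnetMyers`). The proof works with the primitive F of f s^(N-1), which
vanishes at both ends when f has mean zero: |f'|² s^(N-1) - Nκ f² s^(N-1) equals a total derivative
plus two squares, both zero for f = cos(r x).

For D < π/r the density dips at D/2, so a test function odd about D/2, which has mean zero by
symmetry, can change sign there at low cost. For D = (π - 2ε)/r the recentred eigenfunction cos(r x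
+ ε) has quotient below Nκ once sin(2ε)^N < cos(ε)^N sin ε, true for small ε since N > 1. This
contradicts monotonicity. For D = π/(2r), cos(2 r x) has quotient below Nκ whenever N > 4. -/

/-! ### The comparison function for positive curvature. -/

theorem sFun_of_pos {κ : ℝ} (hκ : 0 < κ) (x : ℝ) : sFun κ x = Real.sin (√κ * x) / √κ := by
  simp only [sFun, if_pos hκ]; ring

theorem hasDerivAt_sFun {κ : ℝ} (hκ : 0 < κ) (x : ℝ) :
    HasDerivAt (sFun κ) (Real.cos (√κ * x)) x := by
  have hr : √κ ≠ 0 := (Real.sqrt_pos.2 hκ).ne'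
  have h : sFun κ = fun x => Real.sin (√κ * x) / √κ := funext (sFun_of_pos hκ)
  rw [h]
  have := (((hasDerivAt_id x).const_mul (√κ)).sin).div_const (√κ)
  simpa [hr] using this

theorem contDiff_sFun {κ : ℝ} (hκ : 0 < κ) {n : WithTop ℕ∞} : ContDiff ℝ n (sFun κ) := by
  rw [show sFun κ = fun x => Real.sin (√κ * x) / √κ from funext (sFun_of_pos hκ)]
  fun_prop

theorem continuous_sFun {κ : ℝ} (hκ : 0 < κ) : Continuous (sFun κ) :=
  (contDiff_sFun hκ (n := 0)).continuous

theorem sFun_pos {κ x : ℝ} (hκ : 0 < κ) (hx : 0 < x) (hx' : x < Real.pi / √κ) :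
    0 < sFun κ x := by
  have hr : 0 < √κ := Real.sqrt_pos.2 hκ
  rw [sFun_of_pos hκ]
  rw [lt_div_iff₀ hr] at hx'
  exact div_pos (Real.sin_pos_of_pos_of_lt_pi (by positivity) (by linarith)) hr

theorem sFun_nonneg {κ x : ℝ} (hκ : 0 < κ) (hx : 0 ≤ x) (hx' : x ≤ Real.pi / √κ) :
    0 ≤ sFun κ x := by
  have hr : 0 < √κ := Real.sqrt_pos.2 hκ
  rw [sFun_of_pos hκ]
  rw [le_div_iff₀ hr] at hx'
  exact div_nonneg (Real.sin_nonneg_of_nonneg_of_le_pi (by positivity) (by linarith)) hr.le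

theorem sFun_reflect {κ : ℝ} (hκ : 0 < κ) (x : ℝ) : sFun κ (Real.pi / √κ - x) = sFun κ x := by
  have hr : √κ ≠ 0 := (Real.sqrt_pos.2 hκ).ne'
  rw [sFun_of_pos hκ, sFun_of_pos hκ, mul_sub, mul_div_cancel₀ _ hr, Real.sin_pi_sub]

/-! ### The model density as a continuous symmetric weight, and odd test functions. -/

/-- The continuous function on `ℝ` that agrees with `modelDensity K N D` on `[0, D]`. -/
noncomputable def foldedDensity (K N D : ℝ) (x : ℝ) : ℝ :=
  sFun (K / (N - 1)) (max x (D - x)) ^ (N - 1)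

theorem modelDensity_eq_indicator (K N D : ℝ) :
    modelDensity K N D = (Icc 0 D).indicator (foldedDensity K N D) := by
  ext x
  simp only [modelDensity, foldedDensity, indicator, mem_Icc]
  by_cases h : 0 ≤ x ∧ x ≤ D
  · rw [if_pos h]
    by_cases h1 : x ≤ D / 2
    · rw [if_pos ⟨h.1, h1⟩, max_eq_right (by linarith)]
    · rw [if_neg (fun h2 => h1 h2.2), if_pos ⟨by linarith, h.2⟩, max_eq_left (by linarith)]
  · rw [if_neg h, if_neg (fun h2 => h ⟨h2.1, by linarith [h2.1, h2.2]⟩),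
      if_neg (fun h2 => h ⟨by linarith [h2.1, h2.2], h2.2⟩)]

section

variable {K N D : ℝ}

theorem continuous_foldedDensity (hK : 0 < K) (hN : 1 < N) :
    Continuous (foldedDensity K N D) := by
  have hκ : 0 < K / (N - 1) := div_pos hK (by linarith)
  have h := continuous_sFun hκ
  exact (h.comp (by fun_prop : Continuous fun x => max x (D - x))).rpow_const
    (fun _ => Or.inr (by linarith))

theorem foldedDensity_nonneg (hK : 0 < K) (hN : 1 < N) (hD : D ≤ bonnetMyers K N) {x : ℝ}
    (hx : x ∈ Icc 0 D) : 0 ≤ foldedDensity K N D x := by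
  have hκ : 0 < K / (N - 1) := div_pos hK (by linarith)
  refine Real.rpow_nonneg (sFun_nonneg hκ (le_max_of_le_left hx.1) ?_) _
  exact (max_le hx.2 (by linarith [hx.1])).trans hD

theorem foldedDensity_reflect (x : ℝ) : foldedDensity K N D (D - x) = foldedDensity K N D x := by
  simp only [foldedDensity, sub_sub_cancel, max_comm]

theorem integral_mul_modelDensity (hD : 0 ≤ D) (g : ℝ → ℝ) :
    ∫ x, g x * modelDensity K N D x = ∫ x in 0..D, g x * foldedDensity K N D x := by
  rw [intervalIntegral.integral_of_le hD, ← integral_Icc_eq_integral_Ioc,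
    ← integral_indicator measurableSet_Icc]
  congr 1; ext x
  rw [modelDensity_eq_indicator, indicator_mul_right]

theorem integrable_mul_modelDensity (hD : 0 ≤ D) {g : ℝ → ℝ}
    (hg : IntervalIntegrable (fun x => g x * foldedDensity K N D x) volume 0 D) :
    Integrable (fun x => g x * modelDensity K N D x) := by
  rw [intervalIntegrable_iff_integrableOn_Icc_of_le hD,
    ← integrable_indicator_iff measurableSet_Icc] at hg
  refine hg.congr (Eventually.of_forall fun x => ?_)
  simp only [modelDensity_eq_indicator, indicator_mul_right]

theorem lintegral_mul_modelDensity (hK : 0 < K) (hN : 1 < N) (hD : 0 ≤ D)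
    (hD' : D ≤ bonnetMyers K N) {g : ℝ → ℝ} (hg0 : ∀ x, 0 ≤ g x)
    (hg : IntervalIntegrable (fun x => g x * foldedDensity K N D x) volume 0 D) :
    ∫⁻ x, ENNReal.ofReal (g x * modelDensity K N D x) =
      ENNReal.ofReal (∫ x in 0..D, g x * foldedDensity K N D x) := by
  rw [← integral_mul_modelDensity hD, ofReal_integral_eq_lintegral_ofReal
    (integrable_mul_modelDensity hD hg)]
  refine Eventually.of_forall fun x => mul_nonneg (hg0 x) ?_
  rw [modelDensity_eq_indicator]
  exact indicator_nonneg (fun x hx => foldedDensity_nonneg hK hN hD' hx) x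

theorem integral_mul_foldedDensity_of_even (hK : 0 < K) (hN : 1 < N) (hD : 0 ≤ D) {g : ℝ → ℝ}
    (hg : Continuous g) (hgD : ∀ x, g (D - x) = g x) :
    ∫ x in 0..D, g x * foldedDensity K N D x =
      2 * ∫ x in (D / 2)..D, g x * sFun (K / (N - 1)) x ^ (N - 1) := by
  have hc : Continuous fun x => g x * foldedDensity K N D x :=
    hg.mul (continuous_foldedDensity hK hN)
  rw [← intervalIntegral.integral_add_adjacent_intervals (b := D / 2)
    (hc.intervalIntegrable _ _) (hc.intervalIntegrable _ _)]
  have h1 : ∫ x in 0..(D / 2), g x * foldedDensity K N D x =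
      ∫ x in (D / 2)..D, g x * foldedDensity K N D x := by
    have := intervalIntegral.integral_comp_sub_left (a := 0) (b := D / 2)
      (fun x => g x * foldedDensity K N D x) D
    simp only [hgD, foldedDensity_reflect] at this
    rw [this]; congr 1 <;> ring
  have h2 : ∫ x in (D / 2)..D, g x * foldedDensity K N D x =
      ∫ x in (D / 2)..D, g x * sFun (K / (N - 1)) x ^ (N - 1) := by
    refine intervalIntegral.integral_congr fun x hx => ?_
    rw [uIcc_of_le (by linarith)] at hx
    simp only [foldedDensity, max_eq_left (by linarith [hx.1] : D - x ≤ x)]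
  rw [h1, h2]; ring

/-- An upper bound for the Poincaré constant from a test function odd about `D / 2`. -/
theorem poincareConst_modelDensity_lt (hK : 0 < K) (hN : 1 < N) (hD : 0 ≤ D)
    (hD' : D ≤ bonnetMyers K N) {f f' : ℝ → ℝ} (hf : ∀ x, HasDerivAt f (f' x) x)
    (hf' : Continuous f') (hodd : ∀ x, f (D - x) = -f x) {c : ℝ} (hc : 0 < c)
    (hlt : ∫ x in (D / 2)..D, (f' x ^ 2 - c * f x ^ 2) * sFun (K / (N - 1)) x ^ (N - 1) < 0) :
    poincareConst (modelDensity K N D) < ENNReal.ofReal c := by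
  have hder : deriv f = f' := funext fun x => (hf x).deriv
  have hfc : Continuous f := continuous_iff_continuousAt.2 fun x => (hf x).continuousAt
  have hC1 : ContDiff ℝ 1 f :=
    contDiff_one_iff_deriv.2 ⟨fun x => (hf x).differentiableAt, hder ▸ hf'⟩
  have hev' : ∀ x, f' (D - x) = f' x := fun x => by
    have h1 : HasDerivAt (fun y => f (D - y)) (-f' (D - x)) x := by
      simpa [Function.comp_def] using (hf (D - x)).comp x ((hasDerivAt_id x).const_sub D)
    have h2 : HasDerivAt (fun y => f (D - y)) (-f' x) x := by
      simp only [hodd]; exact (hf x).neg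
    exact neg_injective (h1.unique h2)
  have hH := continuous_foldedDensity (D := D) hK hN
  have hi : ∀ {g : ℝ → ℝ}, Continuous g →
      IntervalIntegrable (fun x => g x * foldedDensity K N D x) volume 0 D :=
    @fun g hg => (hg.mul hH).intervalIntegrable _ _
  have hiA := hi (by fun_prop : Continuous fun x => f' x ^ 2)
  have hiB := hi (by fun_prop : Continuous fun x => f x ^ 2)
  have hA := lintegral_mul_modelDensity hK hN hD hD' (fun x => sq_nonneg (f' x)) hiA
  have hB := lintegral_mul_modelDensity hK hN hD hD' (fun x => sq_nonneg (f x)) hiB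
  set A := ∫ x in 0..D, f' x ^ 2 * foldedDensity K N D x
  set B := ∫ x in 0..D, f x ^ 2 * foldedDensity K N D x
  have hA0 : 0 ≤ A := intervalIntegral.integral_nonneg hD fun x hx =>
    mul_nonneg (sq_nonneg _) (foldedDensity_nonneg hK hN hD' hx)
  have hAB : A < c * B := by
    have h1 := integral_mul_foldedDensity_of_even (D := D) hK hN hD
      (g := fun x => f' x ^ 2 - c * f x ^ 2) (by fun_prop) (fun x => by simp [hev', hodd])
    have h2 : ∫ x in 0..D, (f' x ^ 2 - c * f x ^ 2) * foldedDensity K N D x = A - c * B := by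
      rw [← intervalIntegral.integral_const_mul, ← intervalIntegral.integral_sub hiA
        (hiB.const_mul c)]
      congr 1; ext x; ring
    linarith
  -- Nontriviality of f is automatic: 0 ≤ A < c B.
  have hB0 : 0 < B := pos_of_mul_pos_right (hA0.trans_lt hAB) hc.le
  have hzero : ∫ x, f x * modelDensity K N D x = 0 := by
    rw [integral_mul_modelDensity hD]
    have := intervalIntegral.integral_comp_sub_left (a := 0) (b := D)
      (fun x => f x * foldedDensity K N D x) D
    simp only [hodd, foldedDensity_reflect, neg_mul, intervalIntegral.integral_neg, sub_zero,
      sub_self] at this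
    linarith
  refine lt_of_le_of_lt (sInf_le ⟨f, hC1.locallyLipschitz, integrable_mul_modelDensity hD (hi hfc), hzero,
    ?_, ?_, rfl⟩) ?_
  · rw [hB]; exact ENNReal.ofReal_pos.2 hB0
  · rw [hB]; exact ENNReal.ofReal_lt_top
  · rw [hder, hA, hB, ← ENNReal.ofReal_div_of_pos hB0]
    exact (ENNReal.ofReal_lt_ofReal_iff hc).2 ((div_lt_iff₀ hB0).2 hAB)

end

/-! ### Upper bounds below the threshold, near the full diameter and at half of it. -/

section

variable {K N : ℝ}

/-- The test function cos(r x + ε) is the full-diameter eigenfunction moved to the centre D/2. Its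
energy deficit is an exact derivative minus κ(N-1) sin²ε s^(N-1), so only boundary values remain;
their sign is `hsin`. -/
theorem poincareConst_modelDensity_lt_of_sin_lt (hK : 0 < K) (hN : 1 < N) {ε : ℝ} (hε : 0 < ε)
    (hε' : ε < Real.pi / 2) (hsin : Real.sin (2 * ε) ^ N < Real.cos ε ^ N * Real.sin ε) :
    poincareConst (modelDensity K N ((Real.pi - 2 * ε) / √(K / (N - 1)))) <
      ENNReal.ofReal (N * (K / (N - 1))) := by
  have hκ : 0 < K / (N - 1) := div_pos hK (by linarith)
  set κ := K / (N - 1) with hκdef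
  have hr : 0 < √κ := Real.sqrt_pos.2 hκ
  have hr2 : √κ * √κ = κ := Real.mul_self_sqrt hκ.le
  set r := √κ with hrdef
  set D := (Real.pi - 2 * ε) / r with hDdef
  have hD : 0 < D := div_pos (by linarith) hr
  have hDlt : D < Real.pi / r := div_lt_div_of_pos_right (by linarith) hr
  have hrD : r * D = Real.pi - 2 * ε := mul_div_cancel₀ _ hr.ne'
  have hrD2 : r * (D / 2) = Real.pi / 2 - ε := by linarith
  refine poincareConst_modelDensity_lt hK hN hD.le hDlt.le
    (f := fun x => Real.cos (r * x + ε)) (f' := fun x => -r * Real.sin (r * x + ε)) (fun x => ?_)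
    (by fun_prop) (fun x => ?_) (mul_pos (by linarith) hκ) ?_
  · exact (((hasDerivAt_const_mul r).add_const ε).cos).congr_deriv (by ring)
  · rw [← Real.cos_pi_sub]; congr 1; linarith
  rw [← hκdef]
  -- Expanding the deficit in cos(2 r x) and sin(2 r x), these two terms are primitives of the
  -- oscillating parts times s^(N-1).
  let Φ : ℝ → ℝ := fun x => κ * (-Real.cos (2 * ε) * (Real.cos (r * x) * sFun κ x ^ N) +
    r * Real.sin (2 * ε) * sFun κ x ^ (N + 1))
  have hs := hasDerivAt_sFun hκ
  have hcos : ∀ x, HasDerivAt (fun x => Real.cos (r * x)) (-κ * sFun κ x) x := fun x =>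
    ((hasDerivAt_const_mul r).cos).congr_deriv (by
      rw [sFun_of_pos hκ, ← hrdef, ← hr2]; field_simp)
  have hle : ∫ x in (D / 2)..D, ((-r * Real.sin (r * x + ε)) ^ 2 -
      N * κ * Real.cos (r * x + ε) ^ 2) * sFun κ x ^ (N - 1) ≤ Φ D - Φ (D / 2) := by
    have hΦ : ∀ x, HasDerivAt Φ (κ * (-Real.cos (2 * ε) * (-κ * sFun κ x * sFun κ x ^ N +
        Real.cos (r * x) * (Real.cos (r * x) * N * sFun κ x ^ (N - 1))) +
        r * Real.sin (2 * ε) * (Real.cos (r * x) * (N + 1) * sFun κ x ^ (N + 1 - 1)))) x :=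
      fun x => ((((hcos x).mul ((hs x).rpow_const (Or.inr hN.le))).const_mul _).add
        (((hs x).rpow_const (Or.inr (by linarith))).const_mul _)).const_mul _
    refine intervalIntegral.integral_le_sub_of_hasDeriv_right_of_le (by linarith)
      (fun x _ => (hΦ x).continuousAt.continuousWithinAt) (fun x _ => (hΦ x).hasDerivWithinAt)
      (Continuous.integrableOn_Icc ?_) fun x hx => ?_
    · have := (continuous_sFun hκ).rpow_const (p := N - 1) (fun _ => Or.inr (by linarith))
      fun_prop
    have hsx : 0 < sFun κ x := sFun_pos hκ (by linarith [hx.1]) (by linarith [hx.2])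
    have e1 : sFun κ x ^ N = sFun κ x ^ (N - 1) * sFun κ x := by
      rw [← Real.rpow_add_one hsx.ne']; ring_nf
    rw [add_sub_cancel_right, e1]
    have hsr : Real.sin (r * x) = r * sFun κ x := by
      rw [sFun_of_pos hκ, ← hrdef]; field_simp
    have hP : 0 < sFun κ x ^ (N - 1) := Real.rpow_pos_of_pos hsx _
    rw [Real.sin_add, Real.cos_add, Real.sin_two_mul, Real.cos_two_mul']
    set S := Real.sin (r * x)
    set C := Real.cos (r * x)
    set a := Real.sin ε
    set b := Real.cos ε
    set P := sFun κ x ^ (N - 1)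
    have key : (-r * (S * b + C * a)) ^ 2 - N * κ * (C * b - S * a) ^ 2 ≤
        κ * (-(b ^ 2 - a ^ 2) * (-S ^ 2 + N * C ^ 2) + 2 * a * b * (N + 1) * (C * S)) := by
      have : κ * (-(b ^ 2 - a ^ 2) * (-S ^ 2 + N * C ^ 2) + 2 * a * b * (N + 1) * (C * S)) -
          ((-r * (S * b + C * a)) ^ 2 - N * κ * (C * b - S * a) ^ 2) =
          κ * ((N - 1) * a ^ 2 * (S ^ 2 + C ^ 2)) := by rw [← hr2]; ring
      have h2 : 0 ≤ κ * ((N - 1) * a ^ 2 * (S ^ 2 + C ^ 2)) :=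
        mul_nonneg hκ.le (mul_nonneg (mul_nonneg (by linarith) (sq_nonneg _)) (by positivity))
      linarith
    refine (mul_le_mul_of_nonneg_right key hP.le).trans_eq ?_
    rw [hsr, ← hr2]; ring
  refine hle.trans_lt ?_
  have hsD : sFun κ D = Real.sin (2 * ε) / r := by
    rw [sFun_of_pos hκ, ← hrdef, hrD, Real.sin_pi_sub]
  have hsD2 : sFun κ (D / 2) = Real.cos ε / r := by
    rw [sFun_of_pos hκ, ← hrdef, hrD2, Real.sin_pi_div_two_sub]
  have hS0 : 0 < Real.sin (2 * ε) := Real.sin_pos_of_pos_of_lt_pi (by linarith) (by linarith)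
  have hC0 : 0 < Real.cos ε := Real.cos_pos_of_mem_Ioo ⟨by linarith, hε'⟩
  have e : ∀ {y : ℝ}, 0 < y → (y / r) ^ (N + 1) = (y / r) ^ N * (y / r) := fun hy =>
    Real.rpow_add_one (div_pos hy hr).ne' _
  simp only [Φ]
  rw [hrD, hrD2, hsD, hsD2, e hS0, e hC0, Real.cos_pi_sub, Real.cos_pi_div_two_sub,
    Real.div_rpow hS0.le hr.le, Real.div_rpow hC0.le hr.le]
  have hrN : 0 < r ^ N := Real.rpow_pos_of_pos hr _
  have h2 := Real.sin_sq_add_cos_sq (2 * ε)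
  have : κ * (-Real.cos (2 * ε) * (-Real.cos (2 * ε) * (Real.sin (2 * ε) ^ N / r ^ N)) +
      r * Real.sin (2 * ε) * (Real.sin (2 * ε) ^ N / r ^ N * (Real.sin (2 * ε) / r))) -
      κ * (-Real.cos (2 * ε) * (Real.sin ε * (Real.cos ε ^ N / r ^ N)) +
      r * Real.sin (2 * ε) * (Real.cos ε ^ N / r ^ N * (Real.cos ε / r))) =
      κ / r ^ N * (Real.sin (2 * ε) ^ N * (Real.sin (2 * ε) ^ 2 + Real.cos (2 * ε) ^ 2) -
        Real.cos ε ^ N * (Real.sin (2 * ε) * Real.cos ε - Real.cos (2 * ε) * Real.sin ε)) := by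
    field_simp
    ring
  rw [this, h2, ← Real.sin_sub, mul_one, show 2 * ε - ε = ε by ring]
  exact mul_neg_of_pos_of_neg (by positivity) (by linarith)

/-- After division by cos(ε)^N sin ε, the claim is 2^N sin(ε)^(N-1) < 1, and the left side tends to
0 with ε. -/
theorem exists_sin_two_mul_rpow_lt (hN : 1 < N) : ∃ ε, 0 < ε ∧ ε < Real.pi / 2 ∧
    Real.sin (2 * ε) ^ N < Real.cos ε ^ N * Real.sin ε := by
  have hc : Tendsto (fun ε => 2 ^ N * Real.sin ε ^ (N - 1)) (𝓝[>] 0) (𝓝 0) := by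
    have : Continuous fun ε => (2 : ℝ) ^ N * Real.sin ε ^ (N - 1) :=
      (Real.continuous_sin.rpow_const fun _ => Or.inr (by linarith)).const_mul _
    have h := this.tendsto 0
    rw [Real.sin_zero, Real.zero_rpow (by linarith), mul_zero] at h
    exact h.mono_left nhdsWithin_le_nhds
  obtain ⟨ε, h1, h2⟩ := ((hc.eventually_lt_const one_pos).and
    (Ioo_mem_nhdsGT Real.pi_div_two_pos)).exists
  have hs : 0 < Real.sin ε :=
    Real.sin_pos_of_pos_of_lt_pi h2.1 (by linarith [h2.2, Real.pi_pos])
  have hc : 0 < Real.cos ε := Real.cos_pos_of_mem_Ioo ⟨by linarith [h2.1, h2.2], h2.2⟩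
  refine ⟨ε, h2.1, h2.2, ?_⟩
  have e : Real.sin (2 * ε) ^ N =
      Real.cos ε ^ N * (Real.sin ε * (2 ^ N * Real.sin ε ^ (N - 1))) := by
    rw [Real.sin_two_mul, Real.mul_rpow (by positivity) hc.le, Real.mul_rpow (by positivity) hs.le,
      show Real.sin ε ^ N = Real.sin ε ^ (N - 1) * Real.sin ε by
        rw [← Real.rpow_add_one hs.ne']; ring_nf]
    ring
  rw [e]
  exact mul_lt_mul_of_pos_left (mul_lt_of_lt_one_right hs h1) (Real.rpow_pos_of_pos hc _)

/-- For f = cos(2 r x), the deficit f'² - Nκ f² is -4κ cos(4 r x) - (N-4)κ f². Integrated by parts,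
the first term contributes at most 0, because s^(N-1) increases on [D/2, D] while sin(4 r x) ≤ 0
there and vanishes at both ends. -/
theorem poincareConst_modelDensity_half_lt (hK : 0 < K) (hN : 4 < N) :
    poincareConst (modelDensity K N (bonnetMyers K N / 2)) <
      ENNReal.ofReal (N * (K / (N - 1))) := by
  have hκ : 0 < K / (N - 1) := div_pos hK (by linarith)
  have hDdef : bonnetMyers K N / 2 = Real.pi / √(K / (N - 1)) / 2 := rfl
  have hDle : bonnetMyers K N / 2 ≤ bonnetMyers K N := by
    have : 0 ≤ bonnetMyers K N := div_nonneg Real.pi_pos.le (Real.sqrt_nonneg _)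
    linarith
  set D := bonnetMyers K N / 2
  set κ := K / (N - 1) with hκdef
  have hr : 0 < √κ := Real.sqrt_pos.2 hκ
  have hr2 : √κ * √κ = κ := Real.mul_self_sqrt hκ.le
  set r := √κ with hrdef
  have hD : 0 < D := by rw [hDdef]; positivity
  have hrD : r * D = Real.pi / 2 := by rw [hDdef]; field_simp
  refine poincareConst_modelDensity_lt hK (by linarith) hD.le hDle
    (f := fun x => Real.cos (2 * (r * x))) (f' := fun x => -(2 * r) * Real.sin (2 * (r * x)))
    (fun x => ?_) (by fun_prop) (fun x => ?_) (mul_pos (by linarith) hκ) ?_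
  · exact (((hasDerivAt_const_mul r).const_mul 2).cos).congr_deriv (by ring)
  · rw [← Real.cos_pi_sub]; congr 1; linarith
  rw [← hκdef]
  have hpc : Continuous fun x => sFun κ x ^ (N - 1) :=
    (continuous_sFun hκ).rpow_const (p := N - 1) (fun _ => Or.inr (by linarith))
  let Φ : ℝ → ℝ := fun x => -r * Real.sin (4 * (r * x)) * sFun κ x ^ (N - 1)
  have hle : ∫ x in (D / 2)..D, (-4 * κ * Real.cos (4 * (r * x))) * sFun κ x ^ (N - 1) ≤
      Φ D - Φ (D / 2) := by
    have hΦ : ∀ x, HasDerivAt Φ (-4 * κ * Real.cos (4 * (r * x)) * sFun κ x ^ (N - 1) +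
        -r * Real.sin (4 * (r * x)) *
          (Real.cos (r * x) * (N - 1) * sFun κ x ^ (N - 1 - 1))) x := fun x => by
      have h1 : HasDerivAt (fun x => -r * Real.sin (4 * (r * x)))
          (-4 * κ * Real.cos (4 * (r * x))) x := by
        exact ((((hasDerivAt_const_mul r).const_mul 4).sin).const_mul (-r)).congr_deriv (by
          rw [← hr2]; ring)
      exact h1.mul ((hasDerivAt_sFun hκ x).rpow_const (Or.inr (by linarith)))
    refine intervalIntegral.integral_le_sub_of_hasDeriv_right_of_le (by linarith)
      (fun x _ => (hΦ x).continuousAt.continuousWithinAt) (fun x _ => (hΦ x).hasDerivWithinAt)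
      (Continuous.integrableOn_Icc (by fun_prop)) fun x hx => ?_
    have hy1 : Real.pi / 4 < r * x := by
      have := mul_lt_mul_of_pos_left hx.1 hr; linarith
    have hy2 : r * x < Real.pi / 2 := by
      have := mul_lt_mul_of_pos_left hx.2 hr; linarith
    have hs4 : Real.sin (4 * (r * x)) ≤ 0 := by
      rw [← Real.sin_sub_two_pi]
      exact Real.sin_nonpos_of_nonpos_of_neg_pi_le (by linarith) (by linarith)
    have hC : 0 ≤ Real.cos (r * x) :=
      Real.cos_nonneg_of_mem_Icc ⟨by linarith [Real.pi_pos], by linarith⟩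
    have hs0 : 0 ≤ sFun κ x := sFun_nonneg hκ (by linarith [hx.1]) (hx.2.le.trans hDle)
    have : 0 ≤ -r * Real.sin (4 * (r * x)) *
          (Real.cos (r * x) * (N - 1) * sFun κ x ^ (N - 1 - 1)) :=
      mul_nonneg (mul_nonneg_of_nonpos_of_nonpos (by linarith) hs4)
        (mul_nonneg (mul_nonneg hC (by linarith)) (Real.rpow_nonneg hs0 _))
    linarith
  have hends : Φ D - Φ (D / 2) = 0 := by
    simp only [Φ]
    rw [show 4 * (r * D) = 2 * Real.pi by linarith, show 4 * (r * (D / 2)) = Real.pi by linarith]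
    simp
  -- The strict inequality comes from this term, weighted by (N-4)κ > 0.
  have hpos : 0 < ∫ x in (D / 2)..D, Real.cos (2 * (r * x)) ^ 2 * sFun κ x ^ (N - 1) := by
    refine intervalIntegral.intervalIntegral_pos_of_pos_on
      (Continuous.intervalIntegrable (by fun_prop) _ _) (fun x hx => ?_) (by linarith)
    have hy1 : Real.pi / 4 < r * x := by
      have := mul_lt_mul_of_pos_left hx.1 hr; linarith
    have hy2 : r * x < Real.pi / 2 := by
      have := mul_lt_mul_of_pos_left hx.2 hr; linarith
    have hc : Real.cos (2 * (r * x)) < 0 :=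
      Real.cos_neg_of_pi_div_two_lt_of_lt (by linarith) (by linarith)
    have hD2 : D * 2 = Real.pi / r := by rw [hDdef]; ring
    exact mul_pos (sq_pos_of_neg hc) (Real.rpow_pos_of_pos
      (sFun_pos hκ (by linarith [hx.1]) (by linarith [hx.2])) _)
  have hsplit : ∫ x in (D / 2)..D, ((-(2 * r) * Real.sin (2 * (r * x))) ^ 2 -
      N * κ * Real.cos (2 * (r * x)) ^ 2) * sFun κ x ^ (N - 1) =
      (∫ x in (D / 2)..D, (-4 * κ * Real.cos (4 * (r * x))) * sFun κ x ^ (N - 1)) -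
      (N - 4) * κ * ∫ x in (D / 2)..D, Real.cos (2 * (r * x)) ^ 2 * sFun κ x ^ (N - 1) := by
    rw [← intervalIntegral.integral_const_mul, ← intervalIntegral.integral_sub
      (Continuous.intervalIntegrable (by fun_prop) _ _)
      (Continuous.intervalIntegrable (by fun_prop) _ _)]
    congr 1; ext x
    rw [show 4 * (r * x) = 2 * (2 * (r * x)) by ring, Real.cos_two_mul (2 * (r * x)), mul_pow,
      Real.sin_sq]
    linear_combination 4 * (1 - Real.cos (2 * (r * x)) ^ 2) * sFun κ x ^ (N - 1) * hr2
  rw [hsplit]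
  have : 0 < (N - 4) * κ := mul_pos (by linarith) hκ
  have := mul_pos this hpos
  rw [hends] at hle
  linarith

end

/-! ### Size of the primitive near an endpoint. -/

section

variable {κ N : ℝ}

theorem sFun_mono {x y : ℝ} (hκ : 0 < κ) (hx : 0 ≤ x) (hxy : x ≤ y)
    (hy : y ≤ Real.pi / √κ / 2) : sFun κ x ≤ sFun κ y := by
  have hr : 0 < √κ := Real.sqrt_pos.2 hκ
  rw [sFun_of_pos hκ, sFun_of_pos hκ]
  have h1 : √κ * y ≤ Real.pi / 2 := by
    have := mul_le_mul_of_nonneg_left hy hr.le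
    rwa [show √κ * (Real.pi / √κ / 2) = Real.pi / 2 by field_simp] at this
  have h2 := mul_le_mul_of_nonneg_left hxy hr.le
  have h3 := mul_nonneg hr.le hx
  exact div_le_div_of_nonneg_right
    (Real.sin_le_sin_of_le_of_le_pi_div_two (by linarith [Real.pi_pos]) h1 h2) hr.le

theorem mul_le_sFun {x : ℝ} (hκ : 0 < κ) (hx : 0 ≤ x) (hx' : x ≤ Real.pi / √κ / 2) :
    2 / Real.pi * x ≤ sFun κ x := by
  have hr : 0 < √κ := Real.sqrt_pos.2 hκ
  rw [sFun_of_pos hκ, le_div_iff₀ hr]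
  have h1 : √κ * x ≤ Real.pi / 2 := by
    have := mul_le_mul_of_nonneg_left hx' hr.le
    rwa [show √κ * (Real.pi / √κ / 2) = Real.pi / 2 by field_simp] at this
  have := Real.mul_le_sin (mul_nonneg hr.le hx) h1
  linarith

theorem continuous_sFun_rpow (hκ : 0 < κ) (hN : 1 < N) :
    Continuous fun x => sFun κ x ^ (N - 1) :=
  (continuous_sFun hκ).rpow_const fun _ => Or.inr (by linarith)

theorem sFun_rpow_eq_mul {x : ℝ} (hs : 0 < sFun κ x) :
    sFun κ x ^ N = sFun κ x ^ (N - 1) * sFun κ x := by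
  rw [← Real.rpow_add_one hs.ne', sub_add_cancel]

/-- Near 0, s is increasing, so the integral is at most M x s(x)^(N-1). With x ≤ (π/2) s(x), the
quotient is at most a constant times x s(x)^(N-1). This removes the singular boundary term. -/
theorem tendsto_sq_integral_div_sFun_rpow (hκ : 0 < κ) (hN : 1 < N) {f : ℝ → ℝ}
    (hf : Continuous f) :
    Tendsto (fun x => (∫ t in 0..x, f t * sFun κ t ^ (N - 1)) ^ 2 / sFun κ x ^ N)
      (𝓝[>] 0) (𝓝 0) := by
  have hr : 0 < √κ := Real.sqrt_pos.2 hκ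
  have hD : 0 < Real.pi / √κ / 2 := by positivity
  obtain ⟨M, hM⟩ := (isCompact_Icc (a := 0) (b := Real.pi / √κ / 2)).exists_bound_of_continuousOn
    hf.continuousOn
  have hlim : Tendsto (fun x => M ^ 2 * (Real.pi / 2) * (x * sFun κ x ^ (N - 1)))
      (𝓝[>] 0) (𝓝 0) := by
    have hc := continuous_sFun_rpow hκ hN
    have : Continuous fun x => M ^ 2 * (Real.pi / 2) * (x * sFun κ x ^ (N - 1)) := by fun_prop
    have h := this.tendsto 0
    simp only [zero_mul, mul_zero] at h
    exact h.mono_left nhdsWithin_le_nhds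
  refine squeeze_zero' ?_ ?_ hlim
  all_goals
    filter_upwards [Ioo_mem_nhdsGT hD] with x hx
    have hs : 0 < sFun κ x := sFun_pos hκ hx.1 (by linarith [hx.2])
  · positivity
  have hP : 0 < sFun κ x ^ (N - 1) := Real.rpow_pos_of_pos hs _
  have hF : ‖∫ t in 0..x, f t * sFun κ t ^ (N - 1)‖ ≤ M * sFun κ x ^ (N - 1) * |x - 0| := by
    refine intervalIntegral.norm_integral_le_of_norm_le_const fun t ht => ?_
    rw [uIoc_of_le hx.1.le] at ht
    have hst : 0 ≤ sFun κ t := sFun_nonneg hκ ht.1.le (by linarith [hx.2, ht.2])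
    have h1 := hM t ⟨ht.1.le, by linarith [hx.2, ht.2]⟩
    rw [norm_mul, Real.norm_of_nonneg (Real.rpow_nonneg hst _)]
    exact mul_le_mul h1 (Real.rpow_le_rpow hst (sFun_mono hκ ht.1.le ht.2 hx.2.le)
      (by linarith)) (Real.rpow_nonneg hst _) ((norm_nonneg _).trans h1)
  rw [sub_zero, abs_of_pos hx.1, Real.norm_eq_abs] at hF
  have hF2 := pow_le_pow_left₀ (abs_nonneg _) hF 2
  rw [sq_abs] at hF2
  rw [sFun_rpow_eq_mul hs, div_le_iff₀ (by positivity)]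
  refine hF2.trans ?_
  have h2 : x ≤ Real.pi / 2 * sFun κ x := by
    have := mul_le_mul_of_nonneg_left (mul_le_sFun hκ hx.1.le hx.2.le) Real.pi_div_two_pos.le
    rwa [show Real.pi / 2 * (2 / Real.pi * x) = x by field_simp] at this
  have h3 := mul_le_mul_of_nonneg_left h2
    (by positivity [hx.1] : 0 ≤ M ^ 2 * (sFun κ x ^ (N - 1)) ^ 2 * x)
  linarith

end

/-! ### The sharp Poincaré inequality at the full diameter. -/

section

variable {κ N : ℝ}

theorem intervalIntegrable_deriv_sq_mul {f g : ℝ → ℝ} {a b : ℝ} (hab : a ≤ b)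
    (hf : LocallyLipschitz f) (hg : Continuous g) :
    IntervalIntegrable (fun x => deriv f x ^ 2 * g x) volume a b := by
  obtain ⟨L, hL⟩ := (hf.locallyLipschitzOn (s := Icc a b)).exists_lipschitzOnWith_of_compact
    isCompact_Icc
  have h : IntervalIntegrable (fun x => deriv f x ^ 2) volume a b := by
    rw [intervalIntegrable_iff_integrableOn_Ioo_of_le hab]
    refine Measure.integrableOn_of_bounded (M := (L : ℝ) ^ 2) (by simp)
      ((measurable_deriv f).pow_const 2).aestronglyMeasurable ?_
    filter_upwards [ae_restrict_mem measurableSet_Ioo] with x hx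
    have := norm_deriv_le_of_lipschitzOn (Icc_mem_nhds hx.1 hx.2) hL
    rw [norm_pow]
    exact pow_le_pow_left₀ (norm_nonneg _) this 2
  exact h.mul_continuousOn hg.continuousOn

/-- The boundary term in the integrated Poincaré inequality for the density `sFun κ ^ (N - 1)`,
where `F` is a primitive of `f * sFun κ ^ (N - 1)`. -/
noncomputable def poincareBoundary (κ N : ℝ) (f F : ℝ → ℝ) (x : ℝ) : ℝ :=
  -2 * (N * κ) * (f x * F x) +
    N * κ * N * (Real.cos (√κ * x) * (F x ^ 2 / sFun κ x ^ N))

/-- With P = s^(N-1) and C = cos(√κ x), the difference of the two sides is (dP + NκF)²/P + Nκ(fP -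
NCF/s)²/P. Both squares vanish in the extremal case f = C, F = s^N/N. -/
theorem deriv_poincareBoundary_le (hκ : 0 < κ) (hN : 1 < N) {f F : ℝ → ℝ} {x d : ℝ}
    (hs : 0 < sFun κ x) (hf : HasDerivAt f d x)
    (hF : HasDerivAt F (f x * sFun κ x ^ (N - 1)) x) :
    deriv (poincareBoundary κ N f F) x ≤
      d ^ 2 * sFun κ x ^ (N - 1) - N * κ * (f x ^ 2 * sFun κ x ^ (N - 1)) := by
  have hr : 0 < √κ := Real.sqrt_pos.2 hκ
  have hcos : HasDerivAt (fun x => Real.cos (√κ * x)) (-κ * sFun κ x) x :=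
    ((hasDerivAt_const_mul (√κ)).cos).congr_deriv (by
      rw [sFun_of_pos hκ]; nth_rw 3 [← Real.mul_self_sqrt hκ.le]; field_simp)
  have hsN : HasDerivAt (fun x => sFun κ x ^ N)
      (Real.cos (√κ * x) * N * sFun κ x ^ (N - 1)) x :=
    (hasDerivAt_sFun hκ x).rpow_const (Or.inl hs.ne')
  have hN0 : sFun κ x ^ N ≠ 0 := (Real.rpow_pos_of_pos hs _).ne'
  have hΨ : HasDerivAt (poincareBoundary κ N f F) _ x :=
    ((hf.mul hF).const_mul (-2 * (N * κ))).add
      ((hcos.mul ((hF.pow 2).div hsN hN0)).const_mul (N * κ * N))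
  rw [hΨ.deriv, ← sub_nonneg]
  simp only [Pi.pow_apply, Pi.div_apply, sFun_rpow_eq_mul (N := N) hs]
  have hP : 0 < sFun κ x ^ (N - 1) := Real.rpow_pos_of_pos hs _
  set P := sFun κ x ^ (N - 1)
  set s := sFun κ x
  set C := Real.cos (√κ * x)
  have h1 : 0 ≤ (d * P + N * κ * F x) ^ 2 / P := by positivity
  have h2 : 0 ≤ N * κ * ((f x * P - N * C * F x / s) ^ 2 / P) := by positivity
  refine (add_nonneg h1 h2).trans_eq ?_
  clear_value P s C
  field_simp
  ring

theorem absolutelyContinuousOnInterval_poincareBoundary (hκ : 0 < κ) {f F : ℝ → ℝ}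
    (hf : LocallyLipschitz f) (hF : ContDiff ℝ 1 F) {a b : ℝ} (hab : a ≤ b)
    (hs : ∀ x ∈ Icc a b, 0 < sFun κ x) :
    AbsolutelyContinuousOnInterval (poincareBoundary κ N f F) a b := by
  obtain ⟨L, hL⟩ := (hf.locallyLipschitzOn (s := uIcc a b)).exists_lipschitzOnWith_of_compact
    isCompact_uIcc
  have h1 : AbsolutelyContinuousOnInterval F a b := hF.contDiffOn.absolutelyContinuousOnInterval
  have h2 : ContDiffOn ℝ 1 (fun x => Real.cos (√κ * x) * (F x ^ 2 / sFun κ x ^ N)) (uIcc a b) := by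
    rw [uIcc_of_le hab]
    have hsN : ContDiffOn ℝ 1 (fun x => sFun κ x ^ N) (Icc a b) :=
      (contDiff_sFun hκ).contDiffOn.rpow_const_of_ne fun x hx => (hs x hx).ne'
    exact ContDiffOn.mul (by fun_prop) ((hF.contDiffOn.pow 2).div hsN
      fun x hx => (Real.rpow_pos_of_pos (hs x hx) _).ne')
  exact ((hL.absolutelyContinuousOnInterval.mul h1).const_mul _).add
    (h2.absolutelyContinuousOnInterval.const_mul _)

/-- The sharp weighted Poincaré inequality for the density `sFun κ ^ (N - 1)` on
`[0, π / √κ]`. -/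
theorem poincare_inequality_sFun_rpow (hκ : 0 < κ) (hN : 1 < N) {f : ℝ → ℝ}
    (hf : LocallyLipschitz f)
    (hmean : ∫ x in 0..(Real.pi / √κ), f x * sFun κ x ^ (N - 1) = 0) :
    N * κ * ∫ x in 0..(Real.pi / √κ), f x ^ 2 * sFun κ x ^ (N - 1) ≤
      ∫ x in 0..(Real.pi / √κ), deriv f x ^ 2 * sFun κ x ^ (N - 1) := by
  have hr : 0 < √κ := Real.sqrt_pos.2 hκ
  set D := Real.pi / √κ with hDdef
  have hD : 0 < D := by positivity
  have hfc := hf.continuous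
  have hP := continuous_sFun_rpow hκ hN
  have hfP : Continuous fun x => f x * sFun κ x ^ (N - 1) := hfc.mul hP
  let F : ℝ → ℝ := fun x => ∫ t in 0..x, f t * sFun κ t ^ (N - 1)
  have hFd : ∀ x, HasDerivAt F (f x * sFun κ x ^ (N - 1)) x := fun x =>
    intervalIntegral.integral_hasDerivAt_right (hfP.intervalIntegrable _ _)
      hfP.stronglyMeasurable.stronglyMeasurableAtFilter hfP.continuousAt
  have hF1 : ContDiff ℝ 1 F := contDiff_one_iff_deriv.2
    ⟨fun x => (hFd x).differentiableAt, by rwa [funext fun x => (hFd x).deriv]⟩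
  let g : ℝ → ℝ := fun x =>
    deriv f x ^ 2 * sFun κ x ^ (N - 1) - N * κ * (f x ^ 2 * sFun κ x ^ (N - 1))
  have hd : ∀ {a b : ℝ}, a ≤ b →
      IntervalIntegrable (fun x => deriv f x ^ 2 * sFun κ x ^ (N - 1)) volume a b :=
    fun hab => intervalIntegrable_deriv_sq_mul hab hf hP
  have hf2 : ∀ {a b : ℝ},
      IntervalIntegrable (fun x => f x ^ 2 * sFun κ x ^ (N - 1)) volume a b :=
    Continuous.intervalIntegrable (by fun_prop) _ _
  have hg : ∀ {a b : ℝ}, a ≤ b → IntervalIntegrable g volume a b :=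
    fun hab => (hd hab).sub (hf2.const_mul _)
  -- The boundary term is singular where s vanishes, so integrate over [δ, D - δ]. As f is only
  -- locally Lipschitz, absolute continuity supplies the fundamental theorem of calculus.
  have hstep : ∀ δ ∈ Ioo 0 (D / 2), poincareBoundary κ N f F (D - δ) - poincareBoundary κ N f F δ ≤
      (∫ x in 0..(D - δ), g x) - ∫ x in 0..δ, g x := fun δ hδ => by
    have hle : δ ≤ D - δ := by linarith [hδ.2]
    have hs : ∀ x ∈ Icc δ (D - δ), 0 < sFun κ x := fun x hx =>
      sFun_pos hκ (by linarith [hδ.1, hx.1]) (by linarith [hδ.1, hx.2])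
    have hac := absolutelyContinuousOnInterval_poincareBoundary (N := N) hκ hf hF1 hle hs
    obtain ⟨L, hL⟩ := (hf.locallyLipschitzOn
      (s := uIcc δ (D - δ))).exists_lipschitzOnWith_of_compact isCompact_uIcc
    rw [← hac.integral_deriv_eq_sub, intervalIntegral.integral_interval_sub_left
      (hg (by linarith [hδ.1])) (hg hδ.1.le)]
    refine intervalIntegral.integral_mono_ae_restrict hle hac.intervalIntegrable_deriv (hg hle) ?_
    rw [EventuallyLE, ae_restrict_iff' measurableSet_Icc]
    filter_upwards [hL.absolutelyContinuousOnInterval.ae_differentiableAt] with x hx hxm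
    exact deriv_poincareBoundary_le hκ hN (hs x hxm)
      (hx (by rwa [uIcc_of_le hle])).hasDerivAt (hFd x)
  have hG : ContinuousOn (fun x => ∫ t in 0..x, g t) (Icc 0 D) := by
    rw [← uIcc_of_le hD.le]
    exact intervalIntegral.continuousOn_primitive_interval
      ((intervalIntegrable_iff_integrableOn_Icc_of_le hD.le).1 (hg hD.le) |>.mono_set
        (uIcc_of_le hD.le).subset)
  have hev : ∀ᶠ δ in 𝓝[>] (0 : ℝ), δ ∈ Ioo 0 (D / 2) := Ioo_mem_nhdsGT (by linarith)
  have hG0 : Tendsto (fun δ => ∫ x in 0..δ, g x) (𝓝[>] 0) (𝓝 0) := by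
    have h := hG 0 ⟨le_rfl, hD.le⟩
    have h2 := h.tendsto
    rw [intervalIntegral.integral_same] at h2
    refine h2.comp (tendsto_nhdsWithin_iff.2 ⟨tendsto_id.mono_left nhdsWithin_le_nhds, ?_⟩)
    filter_upwards [hev] with δ hδ
    exact ⟨hδ.1.le, by change δ ≤ D; linarith [hδ.2]⟩
  have hsub : Tendsto (fun δ => D - δ) (𝓝[>] 0) (𝓝 D) := by
    have : Continuous fun δ : ℝ => D - δ := by fun_prop
    have h := this.tendsto 0
    rw [sub_zero] at h
    exact h.mono_left nhdsWithin_le_nhds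
  have hGD : Tendsto (fun δ => ∫ x in 0..(D - δ), g x) (𝓝[>] 0) (𝓝 (∫ x in 0..D, g x)) := by
    refine (hG D ⟨hD.le, le_rfl⟩).tendsto.comp (tendsto_nhdsWithin_iff.2 ⟨hsub, ?_⟩)
    filter_upwards [hev] with δ hδ
    exact ⟨by linarith [hδ.2], by linarith [hδ.1]⟩
  have hFc : Continuous F := hF1.continuous
  have hB0 : Tendsto (poincareBoundary κ N f F) (𝓝[>] 0) (𝓝 0) := by
    have h1 : Tendsto (fun x => f x * F x) (𝓝[>] 0) (𝓝 0) := by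
      have h := (by fun_prop : Continuous fun x => f x * F x).tendsto 0
      rw [show F 0 = 0 from intervalIntegral.integral_same, mul_zero] at h
      exact h.mono_left nhdsWithin_le_nhds
    have h2 := ((by fun_prop : Continuous fun x => Real.cos (√κ * x)).tendsto 0).mono_left
      (nhdsWithin_le_nhds (s := Ioi 0))
    have h3 := (h1.const_mul (-2 * (N * κ))).add
      ((h2.mul (tendsto_sq_integral_div_sFun_rpow hκ hN hfc)).const_mul (N * κ * N))
    simp only [mul_zero, add_zero] at h3
    exact h3
  -- The mean-zero condition and the symmetry of s turn the behaviour at D into that at 0 for the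
  -- reflected function.
  have hFD : ∀ δ, F (D - δ) = -∫ t in 0..δ, f (D - t) * sFun κ t ^ (N - 1) := fun δ => by
    have h1 := intervalIntegral.integral_comp_sub_left (a := 0) (b := δ)
      (fun x => f x * sFun κ x ^ (N - 1)) D
    simp only [hDdef, sFun_reflect hκ] at h1
    rw [← hDdef, sub_zero] at h1
    have h2 := intervalIntegral.integral_add_adjacent_intervals (μ := volume)
      (hfP.intervalIntegrable 0 (D - δ)) (hfP.intervalIntegrable (D - δ) D)
    simp only [F]
    linarith
  have hBD : Tendsto (fun δ => poincareBoundary κ N f F (D - δ)) (𝓝[>] 0) (𝓝 0) := by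
    have h1 : Tendsto (fun δ => f (D - δ) * F (D - δ)) (𝓝[>] 0) (𝓝 0) := by
      have h := ((by fun_prop : Continuous fun x => f x * F x).tendsto D).comp hsub
      rwa [show F D = 0 from hmean, mul_zero] at h
    have h2 := ((by fun_prop : Continuous fun δ => Real.cos (√κ * (D - δ))).tendsto 0).mono_left
      (nhdsWithin_le_nhds (s := Ioi 0))
    have h3 := (h1.const_mul (-2 * (N * κ))).add
      ((h2.mul (tendsto_sq_integral_div_sFun_rpow hκ hN
        (f := fun x => f (D - x)) (by fun_prop))).const_mul (N * κ * N))
    simp only [mul_zero, add_zero] at h3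
    refine h3.congr fun δ => ?_
    simp only [poincareBoundary]
    rw [hFD δ, neg_sq, hDdef, sFun_reflect hκ]
  have hfin := le_of_tendsto_of_tendsto (hBD.sub hB0) (hGD.sub hG0) (hev.mono hstep)
  have hgsplit : ∫ x in 0..D, g x = (∫ x in 0..D, deriv f x ^ 2 * sFun κ x ^ (N - 1)) -
      N * κ * ∫ x in 0..D, f x ^ 2 * sFun κ x ^ (N - 1) := by
    rw [← intervalIntegral.integral_const_mul, ← intervalIntegral.integral_sub (hd hD.le)
      (hf2.const_mul _)]
  linarith

theorem foldedDensity_bonnetMyers {K : ℝ} (hK : 0 < K) (hN : 1 < N) (x : ℝ) :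
    foldedDensity K N (bonnetMyers K N) x = sFun (K / (N - 1)) x ^ (N - 1) := by
  have hκ : 0 < K / (N - 1) := div_pos hK (by linarith)
  simp only [foldedDensity, bonnetMyers]
  rcases max_choice x (Real.pi / √(K / (N - 1)) - x) with h | h <;> rw [h]
  rw [sFun_reflect hκ]

theorem ofReal_le_poincareConst_bonnetMyers {K : ℝ} (hK : 0 < K) (hN : 1 < N) :
    ENNReal.ofReal (N * (K / (N - 1))) ≤
      poincareConst (modelDensity K N (bonnetMyers K N)) := by
  have hκ : 0 < K / (N - 1) := div_pos hK (by linarith)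
  have hD : 0 ≤ bonnetMyers K N := div_nonneg Real.pi_pos.le (Real.sqrt_nonneg _)
  refine le_sInf ?_
  rintro q ⟨f, hf, -, hmean, hpos, htop, rfl⟩
  have hfc := hf.continuous
  have hH := continuous_foldedDensity (D := bonnetMyers K N) hK hN
  rw [ENNReal.le_div_iff_mul_le (Or.inl hpos.ne') (Or.inl htop.ne)]
  rw [lintegral_mul_modelDensity hK hN hD le_rfl (fun x => sq_nonneg (f x))
      (Continuous.intervalIntegrable (by fun_prop) _ _),
    lintegral_mul_modelDensity hK hN hD le_rfl (fun x => sq_nonneg (deriv f x))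
      (intervalIntegrable_deriv_sq_mul hD hf hH), ← ENNReal.ofReal_mul (by positivity)]
  rw [integral_mul_modelDensity hD] at hmean
  simp only [foldedDensity_bonnetMyers hK hN] at hmean ⊢
  exact ENNReal.ofReal_le_ofReal (poincare_inequality_sFun_rpow hκ hN hf hmean)

end

/-! ### Comparison of the bounds. -/

theorem mainTheorem12 (K N : ℝ) (hK : 0 < K) (hN : 1 < N) :
    ¬ AntitoneOn (fun D : ℝ => poincareConst (modelDensity K N D))
        (Set.Ioc 0 (bonnetMyers K N)) ∧
      (13 ≤ N →
        poincareConst (modelDensity K N (bonnetMyers K N / 2)) <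
          poincareConst (modelDensity K N (bonnetMyers K N))) := by
  have hlow := ofReal_le_poincareConst_bonnetMyers hK hN
  refine ⟨fun hanti => ?_, fun h13 =>
    (poincareConst_modelDensity_half_lt hK (by linarith)).trans_le hlow⟩
  obtain ⟨ε, h0, h1, h2⟩ := exists_sin_two_mul_rpow_lt hN
  have hr : 0 < √(K / (N - 1)) := Real.sqrt_pos.2 (div_pos hK (by linarith))
  have hle : (Real.pi - 2 * ε) / √(K / (N - 1)) ≤ bonnetMyers K N :=
    div_le_div_of_nonneg_right (by linarith) hr.le
  have hmem : (Real.pi - 2 * ε) / √(K / (N - 1)) ∈ Ioc 0 (bonnetMyers K N) :=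
    ⟨div_pos (by linarith) hr, hle⟩
  exact absurd (hanti hmem ⟨hmem.1.trans_le hle, le_rfl⟩ hle)
    (not_le.2 ((poincareConst_modelDensity_lt_of_sin_lt hK hN h0 h1 h2).trans_le hlow))
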